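/- **Theorem 3.1 (Generalization Error Bound).** Notation. For $\gamma>0$ let $\rho(\omega)=\prod_{j=1}^d \frac{1}{\pi\gamma(1+\omega_j^2/\gamma^2)}$ be the density of the tensor-product Cauchy distribution on $\mathbb R^d$. Let $D\subset\mathbb R^d$ be compact. A function $f:D\to\mathbb C$ belongs to $\mathcal F(\rho)$ if $f(x)=\int_{\mathbb R^d}\hat f(\omega)e^{i\langle\omega,x\rangle}\,d\omega$ for $x\in D$, where $\|f\|_\rho^2:=\mathbb E_{\omega\sim\rho}|\alpha(\omega)|^2<\infty$ with $\alpha:=\hat f/\rho$. (On $D$ the function $\hat f$ need not be unique; the theorem holds for every choice of it.) For points $X=\{x_j\}_{j=1}^m\subset D$, $m\ge 1$, let $h_X=\max_{x\in D}\min_{j}\|x-x_j\|_2$. For $\omega_1,\dots,\omega_N\in\mathbb R^d$ let $A\in\mathbb C^{m\times N}$, $A_{j,k}=e^{i\langle\omega_k,x_j\rangle}$, let $y=(f(x_j))_{j=1}^m$, and set $$f^\sharp(x)=\sum_{k=1}^N c_k^\sharp e^{i\langle\omega_k,x\rangle},\quad c^\sharp\in\operatorname*{argmin}_{c\in\mathbb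 C^N,\;Ac=y}\|c\|_2,\qquad f^*(x)=\frac1N\sum_{k=1}^N\alpha(\omega_k)\mathbf 1_{|\alpha(\omega_k)|\le T}\,e^{i\langle\omega_k,x\rangle},\quad T=\|f\|_\rho\sqrt N .$$ Statement. There is a universal constant $C>0$ such that the following holds. Let $D\subset\mathbb R^d$ be compact, let $x_1,\dots,x_m\in D$, $m\ge1$, satisfy $\|x_j-x_{j'}\|_2\ge K>0$ for all $j\ne j'$, let $\omega_1,\dots,\omega_N$ be i.i.d. with density $\rho$, and let $f\in\mathcal F(\rho)$. Suppose that for some $\delta\in(0,1)$ and $\eta\in(0,\tfrac12)$ $$N\ge C\eta^{-2}m\log\Big(\frac{m}{2\delta}\Big),\qquad \gamma\ge\frac1K\log\Big(\frac m\eta\Big).$$ Then, with probability at least $1-5\delta$, the minimizer $c^\sharp$ exists and is unique, and for every (possibly sample-dependent) $L_f>0$ such that $f^*-f^\sharp$ is $L_f$-Lipschitz on $D$ with respect to $\|\cdot\|_2$, $$\|f-f^\sharp\|_{L^2(D)}^2\le 2\operatorname{vol}(D)\,I_1+4L_f^2h_X^2\operatorname{vol}(D)+2Ch_X^d(1+2\eta)\Big(\frac{2m}{1-2\eta}I_1+2I_2\Big),$$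 where $$I_1:=\frac{2\|f\|_\rho^2}{N}+\frac{32\|f\|_\rho^2\log^2(2/\delta)}{N}+\frac{4\|f\|_\rho^2\log(2/\delta)}{N}\le\frac{96\|f\|_\rho^2\log^2(2/\delta)}{N},$$ $$I_2:=\|f\|_\rho^2+4\|f\|_\rho^2\log(2/\delta)+\sqrt{2\log(2/\delta)}\,\|f\|_\rho^2\le 12\log(2/\delta)\|f\|_\rho^2 .$$ -/

import Mathlib

open MeasureTheory ProbabilityTheory
open scoped NNReal ENNReal

namespace CauchyRF

noncomputable section

/-- The density `ρ(w) = ∏ⱼ 1 / (π γ (1 + wⱼ² / γ²))` of the tensor-product Cauchy distribution on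
`ℝᵈ` with scaling parameter `γ`, as a product of Mathlib's one-dimensional Cauchy densities. -/
def density {d : ℕ} (γ : ℝ≥0) (w : EuclideanSpace ℝ (Fin d)) : ℝ :=
  ∏ j, cauchyPDFReal 0 γ (w j)

/-- The tensor-product Cauchy distribution on `ℝᵈ` with scaling parameter `γ`. -/
def law (d : ℕ) (γ : ℝ≥0) : Measure (EuclideanSpace ℝ (Fin d)) :=
  volume.withDensity fun w => ENNReal.ofReal (density γ w)

/-- The feature `exp(i ⟨w, x⟩)`. -/
def feature {d : ℕ} (w x : EuclideanSpace ℝ (Fin d)) : ℂ :=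
  Complex.exp (Complex.I * ((inner ℝ w x : ℝ) : ℂ))

/-- The function `α = f̂ / ρ`. -/
def amplitude {d : ℕ} (γ : ℝ≥0) (fhat : EuclideanSpace ℝ (Fin d) → ℂ)
    (w : EuclideanSpace ℝ (Fin d)) : ℂ :=
  fhat w / (density γ w : ℂ)

/-- `f : D → ℂ` belongs to the space `𝓕(ρ)`, with frequency-side function `f̂`:
`𝔼_{w ∼ ρ} |f̂(w) / ρ(w)|² < ∞` and `f(x) = ∫ f̂(w) exp(i ⟨w, x⟩) dw` for all `x ∈ D`.
(For `D = ℝᵈ` the function `f̂` is the Fourier transform of `f`, in the normalization in which the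
inversion formula has no factor, and it is determined by `f` almost everywhere.) -/
structure InSpace {d : ℕ} (γ : ℝ≥0) (D : Set (EuclideanSpace ℝ (Fin d)))
    (f fhat : EuclideanSpace ℝ (Fin d) → ℂ) : Prop where
  memLp_amplitude : MemLp (amplitude γ fhat) 2 (law d γ)
  eq_integral : ∀ x ∈ D, f x = ∫ w, fhat w * feature w x

/-- `‖f‖_ρ`, the square root of `𝔼_{w ∼ ρ} |f̂(w) / ρ(w)|²`. -/
def rhoNorm {d : ℕ} (γ : ℝ≥0) (fhat : EuclideanSpace ℝ (Fin d) → ℂ) : ℝ :=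
  Real.sqrt (∫ w, ‖amplitude γ fhat w‖ ^ 2 ∂(law d γ))

/-- The random feature model `x ↦ ∑ₖ cₖ exp(i ⟨wₖ, x⟩)`. -/
def model {d N : ℕ} (w : Fin N → EuclideanSpace ℝ (Fin d)) (c : EuclideanSpace ℂ (Fin N))
    (x : EuclideanSpace ℝ (Fin d)) : ℂ :=
  ∑ k, c k * feature (w k) x

/-- The random feature matrix `A`, with entries `exp(i ⟨wₖ, xⱼ⟩)`. -/
def featureMatrix {d m N : ℕ} (w : Fin N → EuclideanSpace ℝ (Fin d))
    (X : Fin m → EuclideanSpace ℝ (Fin d)) : Matrix (Fin m) (Fin N) ℂ :=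
  Matrix.of fun j k => feature (w k) (X j)

/-- `c ∈ argmin {‖c‖₂ : A c = y}`. -/
def IsMinNormSolution {m N : ℕ} (A : Matrix (Fin m) (Fin N) ℂ) (y : Fin m → ℂ)
    (c : EuclideanSpace ℂ (Fin N)) : Prop :=
  A.mulVec c.ofLp = y ∧ ∀ c' : EuclideanSpace ℂ (Fin N), A.mulVec c'.ofLp = y → ‖c‖ ≤ ‖c'‖

open Classical in
/-- The truncation `α_{≤ T} = α · 𝟙_{|α| ≤ T}`. -/
def truncatedAmplitude {d : ℕ} (γ : ℝ≥0) (fhat : EuclideanSpace ℝ (Fin d) → ℂ) (T : ℝ)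
    (w : EuclideanSpace ℝ (Fin d)) : ℂ :=
  if ‖amplitude γ fhat w‖ ≤ T then amplitude γ fhat w else 0

/-- The best random feature model `f*(x) = N⁻¹ ∑ₖ α_{≤ T}(wₖ) exp(i ⟨wₖ, x⟩)`, at the truncation
level `T = ‖f‖_ρ √N`. -/
def bestModel {d N : ℕ} (γ : ℝ≥0) (fhat : EuclideanSpace ℝ (Fin d) → ℂ)
    (w : Fin N → EuclideanSpace ℝ (Fin d)) (x : EuclideanSpace ℝ (Fin d)) : ℂ :=
  (N : ℂ)⁻¹ * ∑ k,
    truncatedAmplitude γ fhat (rhoNorm γ fhat * Real.sqrt N) (w k) * feature (w k) x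

/-- The fill distance `h_X = max_{x ∈ D} min_j ‖x - xⱼ‖₂`. -/
def fillDistance {d m : ℕ} (D : Set (EuclideanSpace ℝ (Fin d)))
    (X : Fin m → EuclideanSpace ℝ (Fin d)) : ℝ :=
  ⨆ x : D, ⨅ j : Fin m, ‖(x : EuclideanSpace ℝ (Fin d)) - X j‖

/-- `I₁`, as a function of `F = ‖f‖_ρ`, `N` and `δ`. -/
def I₁ (F : ℝ) (N : ℕ) (δ : ℝ) : ℝ :=
  2 * F ^ 2 / N + 32 * F ^ 2 * Real.log (2 / δ) ^ 2 / N + 4 * F ^ 2 * Real.log (2 / δ) / N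

/-- `I₂`, as a function of `F = ‖f‖_ρ` and `δ`. -/
def I₂ (F δ : ℝ) : ℝ :=
  F ^ 2 + 4 * F ^ 2 * Real.log (2 / δ) + Real.sqrt (2 * Real.log (2 / δ)) * F ^ 2

end

end CauchyRF

namespace CauchyRF

/-! The argument compares both `f` and the interpolant `f♯` with the truncated Monte Carlo model
`f*`. Since `f♯ = f` at the nodes, `f* - f♯` equals `f* - f` there, so the size of `f* - f` in mean
square, over `D` and over the nodes, controls everything. The fill distance and the Lipschitz
constant carry the bound from the nodes to `D` (`setIntegral_sq_le_of_lipschitz`), and the triangle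
inequality finishes (`error_bound`).

The mean square of `f* - f` under any probability measure `τ` is at most `I₁` outside an event of
probability `δ` (`measure_I₁_lt_le`). After normalization the summands are bounded by 1 and have
total variance and bias at most 1, so the exponential moments of the error at each point are bounded
by a constant. Convexity of `cosh ∘ √` lets Jensen and Fubini turn this pointwise bound into a tail
bound for the `L²(τ)` norm. It is applied with `τ` uniform on `D` and uniform on the nodes.

Of the matrix `A` only surjectivity is needed. The sample bound gives `m ≤ N`, and an `m × m` minor
of `A` is a nontrivial exponential sum in the frequencies, hence almost surely nonzero
(`ae_det_feature_ne_zero`). The total failure probability is `2δ`. The `I₂` term and the factors in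
`η` only enlarge the right-hand side, and `C` is a dimension-free bound for the volume of unit
balls. -/

/-! ### Zeros of exponential sums and almost sure nonsingularity -/

/-- A real vector space is not a finite union of proper subspaces, here the kernels of the
differences `l i - l j`. -/
theorem exists_injective_eval {V ι : Type*} [AddCommGroup V] [Module ℝ V] [Finite ι]
    (l : ι → V →ₗ[ℝ] ℝ) (hl : Function.Injective l) :
    ∃ u : V, Function.Injective fun i => l i u := by
  classical
  let s : Set (Subspace ℝ V) :=
    (fun p : ι × ι => LinearMap.ker (l p.1 - l p.2)) '' {p | p.1 ≠ p.2}
  have hs : s.Finite := (Set.toFinite _).image _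
  have htop : (⊤ : Subspace ℝ V) ∉ hs.toFinset := by
    simp only [Set.Finite.mem_toFinset, s, Set.mem_image, Set.mem_ofPred_eq, not_exists, not_and]
    intro p hp h
    rw [LinearMap.ker_eq_top, sub_eq_zero] at h
    exact hp (hl h)
  have := Subspace.biUnion_ne_univ_of_top_notMem htop
  obtain ⟨u, hu⟩ := (Set.ne_univ_iff_exists_notMem _).1 this
  refine ⟨u, fun i j hij => ?_⟩
  by_contra hne
  refine hu (Set.mem_biUnion (x := LinearMap.ker (l i - l j)) ?_ ?_)
  · simp only [Set.Finite.coe_toFinset, s]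
    exact ⟨(i, j), hne, rfl⟩
  · simpa [sub_eq_zero] using hij

/-- The character `t ↦ exp(i b t)` of the additive group of the reals. -/
noncomputable def expChar (b : ℝ) : Multiplicative ℝ →* ℂ where
  toFun t := Complex.exp (Complex.I * ((b * t.toAdd : ℝ) : ℂ))
  map_one' := by simp
  map_mul' s t := by
    rw [← Complex.exp_add]
    congr 1
    push_cast [toAdd_mul]
    ring

/-- The derivative at 0 is `i b`, which recovers `b`. -/
theorem expChar_injective : Function.Injective expChar := by
  intro b c h
  have hderiv : ∀ b : ℝ, HasDerivAt (fun t : ℝ => Complex.exp (Complex.I * ((b * t : ℝ) : ℂ)))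
      (Complex.I * b) 0 := by
    intro b
    have h1 : HasDerivAt (fun t : ℝ => Complex.I * ((b * t : ℝ) : ℂ)) (Complex.I * b) 0 := by
      have := ((hasDerivAt_id (0 : ℝ)).const_mul b).ofReal_comp.const_mul Complex.I
      simpa using this
    simpa using h1.cexp
  have hfun : (fun t : ℝ => Complex.exp (Complex.I * ((b * t : ℝ) : ℂ))) =
      fun t : ℝ => Complex.exp (Complex.I * ((c * t : ℝ) : ℂ)) := by
    funext t
    exact DFunLike.congr_fun h (Multiplicative.ofAdd t)
  have := (hderiv b).unique (hfun ▸ hderiv c)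
  simpa using this

/-- A real-analytic function on the line either vanishes identically or has a discrete zero set,
which is null. Dedekind's independence of characters excludes the first case. -/
theorem ae_expSum_ne_zero_real {ι : Type*} [Fintype ι] (b : ι → ℝ) (hb : Function.Injective b)
    (a : ι → ℂ) (ha : a ≠ 0) :
    ∀ᵐ t : ℝ, ∑ i, a i * Complex.exp (Complex.I * ((b i * t : ℝ) : ℂ)) ≠ 0 := by
  have han : AnalyticOnNhd ℝ
      (fun t : ℝ => ∑ i, a i * Complex.exp (Complex.I * ((b i * t : ℝ) : ℂ))) Set.univ := by
    intro t _
    refine Finset.analyticAt_fun_sum _ fun i _ => analyticAt_const.mul ?_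
    have h1 : AnalyticAt ℝ (fun t : ℝ => Complex.I * ((b i * t : ℝ) : ℂ)) t :=
      analyticAt_const.mul
        ((Complex.ofRealCLM.analyticAt (b i * t)).comp (analyticAt_const.mul analyticAt_id))
    exact AnalyticAt.fun_comp (g := Complex.exp) (analyticAt_cexp.restrictScalars (𝕜 := ℝ)) h1
  rcases han.eqOn_zero_or_eventually_ne_zero_of_preconnected isPreconnected_univ with h | h
  · exfalso
    have hli : LinearIndependent ℂ fun i => (expChar (b i) : Multiplicative ℝ → ℂ) :=
      (linearIndependent_monoidHom (Multiplicative ℝ) ℂ).comp (fun i => expChar (b i))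
        (expChar_injective.comp hb)
    rw [Fintype.linearIndependent_iff] at hli
    refine ha (funext fun i => hli a ?_ i)
    funext t
    have := h (Set.mem_univ t.toAdd)
    simpa [expChar, Finset.sum_apply] using this
  · have := ae_restrict_le_codiscreteWithin (μ := volume) MeasurableSet.univ h
    rwa [Measure.restrict_univ] at this

/-- Fubini along lines `y + t u`, with `u` separating the functionals: on each line the sum is
one-dimensional with distinct frequencies, and its coefficients are those of `a` multiplied by
phases, so they do not all vanish. -/
theorem ae_expSum_ne_zero {V ι : Type*} [NormedAddCommGroup V] [NormedSpace ℝ V]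
    [FiniteDimensional ℝ V] [MeasurableSpace V] [BorelSpace V] (μ : Measure V)
    [μ.IsAddHaarMeasure] [Fintype ι] (l : ι → V →ₗ[ℝ] ℝ) (hl : Function.Injective l)
    (a : ι → ℂ) (ha : a ≠ 0) :
    ∀ᵐ v ∂μ, ∑ i, a i * Complex.exp (Complex.I * ((l i v : ℝ) : ℂ)) ≠ 0 := by
  obtain ⟨u, hu⟩ := exists_injective_eval l hl
  have hcont : Continuous fun v => ∑ i, a i * Complex.exp (Complex.I * ((l i v : ℝ) : ℂ)) := by
    have := fun i => (l i).continuous_of_finiteDimensional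
    fun_prop
  have hmeas : MeasurableSet
      {v | ∑ i, a i * Complex.exp (Complex.I * ((l i v : ℝ) : ℂ)) ≠ 0} :=
    (isOpen_ne.preimage hcont).measurableSet
  refine ae_mem_of_ae_add_linearMap_mem (LinearMap.toSpanSingleton ℝ V u) (volume : Measure ℝ) μ
    hmeas fun y => ?_
  have hne : (fun i => a i * Complex.exp (Complex.I * ((l i y : ℝ) : ℂ))) ≠ 0 := by
    intro h
    refine ha (funext fun i => ?_)
    simpa using congrFun h i
  filter_upwards [ae_expSum_ne_zero_real (fun i => l i u) hu _ hne] with t ht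
  refine ne_of_eq_of_ne (Finset.sum_congr rfl fun i _ => ?_) ht
  rw [mul_assoc, ← Complex.exp_add]
  simp only [LinearMap.toSpanSingleton_apply, map_add, map_smul, smul_eq_mul]
  push_cast
  ring_nf

theorem pi_absolutelyContinuous {E : Type*} [MeasurableSpace E] (μ ν : Measure E)
    [SigmaFinite μ] [SigmaFinite ν] (h : μ ≪ ν) (n : ℕ) :
    Measure.pi (fun _ : Fin n => μ) ≪ Measure.pi (fun _ : Fin n => ν) := by
  induction n with
  | zero => rw [Measure.pi_of_empty, Measure.pi_of_empty]
  | succ n ih =>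
    have h1 := (measurePreserving_piFinSuccAbove (fun _ : Fin (n + 1) => μ) 0).symm
    have h2 := (measurePreserving_piFinSuccAbove (fun _ : Fin (n + 1) => ν) 0).symm
    rw [← h1.map_eq, ← h2.map_eq]
    exact (h.prod ih).map (MeasurableEquiv.measurable _)

/-- The Leibniz formula writes the determinant as an exponential sum indexed by permutations, with
signs as coefficients. Distinct nodes make the linear functionals `l σ` distinct. -/
theorem ae_det_feature_ne_zero {d m N : ℕ} (X : Fin m → EuclideanSpace ℝ (Fin d))
    (hX : Function.Injective X) (hmN : m ≤ N) :
    ∀ᵐ w : Fin N → EuclideanSpace ℝ (Fin d),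
      ((featureMatrix w X).submatrix id (Fin.castLE hmN)).det ≠ 0 := by
  classical
  let l : Equiv.Perm (Fin m) → (Fin N → EuclideanSpace ℝ (Fin d)) →ₗ[ℝ] ℝ := fun σ =>
    ∑ k, (innerₗ (EuclideanSpace ℝ (Fin d)) (X (σ k))) ∘ₗ LinearMap.proj (Fin.castLE hmN k)
  have hl : Function.Injective l := by
    intro σ τ h
    ext1 k
    refine hX (ext_inner_right ℝ fun v => ?_)
    have := LinearMap.congr_fun h (Pi.single (Fin.castLE hmN k) v)
    simpa [l, LinearMap.sum_apply, Pi.single_apply, apply_ite, Fin.castLE_inj] using this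
  have ha : (fun σ : Equiv.Perm (Fin m) => ((Equiv.Perm.sign σ : ℤ) : ℂ)) ≠ 0 := by
    intro h
    simpa using congrFun h 1
  filter_upwards [ae_expSum_ne_zero volume l hl _ ha] with w hw
  convert hw using 1
  rw [Matrix.det_apply']
  refine Finset.sum_congr rfl fun σ _ => ?_
  congr 1
  simp only [Matrix.submatrix_apply, featureMatrix, Matrix.of_apply, id, feature, l,
    LinearMap.sum_apply, LinearMap.comp_apply, LinearMap.proj_apply, innerₗ_apply_apply]
  rw [← Complex.exp_sum]
  congr 1
  push_cast
  rw [Finset.mul_sum]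
  refine Finset.sum_congr rfl fun k _ => ?_
  rw [real_inner_comm]

/-! ### Exponential moments and the tail of a mean square -/

/-- The power series `∑ uⁿ / (2n)!` has nonnegative coefficients, so it is a sum of convex
functions. The function `exp ∘ √` is not convex near 0, which is why `cosh` is used. -/
theorem convexOn_cosh_sqrt : ConvexOn ℝ (Set.Ici 0) fun u => Real.cosh (Real.sqrt u) := by
  have hsum : ∀ u : ℝ, 0 ≤ u →
      HasSum (fun n : ℕ => u ^ n / ((2 * n).factorial : ℝ)) (Real.cosh (Real.sqrt u)) := by
    intro u hu
    have := Real.hasSum_cosh (Real.sqrt u)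
    simpa only [pow_mul, Real.sq_sqrt hu] using this
  refine ⟨convex_Ici 0, fun u hu v hv a b ha hb hab => ?_⟩
  have hu' : 0 ≤ u := hu
  have hv' : 0 ≤ v := hv
  have huv : 0 ≤ a * u + b * v := by positivity
  refine hasSum_le (fun n => ?_) (hsum _ huv) (((hsum u hu').mul_left a).add
    ((hsum v hv').mul_left b))
  have hconv := (convexOn_pow n).2 hu hv ha hb hab
  simp only [smul_eq_mul] at hconv
  rw [← mul_div_assoc, ← mul_div_assoc, ← add_div]
  exact div_le_div_of_nonneg_right hconv (by positivity)

/-- Integrate `eˣ ≤ 1 + x + x²`, valid for `|x| ≤ 1`, and then apply `1 + s ≤ eˢ`. -/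
theorem integral_exp_le {E : Type*} [MeasurableSpace E] (μ : Measure E) [IsProbabilityMeasure μ]
    {X : E → ℝ} (hX : Measurable X) (hb : ∀ w, |X w| ≤ 1) :
    ∫ w, Real.exp (X w) ∂μ ≤ Real.exp (∫ w, X w ∂μ + ∫ w, X w ^ 2 ∂μ) := by
  have hXi : Integrable X μ := Integrable.of_bound hX.aestronglyMeasurable 1 (.of_forall hb)
  have hX2 : Integrable (fun w => X w ^ 2) μ :=
    Integrable.of_bound (hX.pow_const 2).aestronglyMeasurable 1 (.of_forall fun w => by
      simpa using hb w)
  have hXe : Integrable (fun w => Real.exp (X w)) μ :=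
    Integrable.of_bound hX.exp.aestronglyMeasurable (Real.exp 1) (.of_forall fun w => by
      rw [Real.norm_eq_abs, Real.abs_exp]
      exact Real.exp_le_exp.2 (le_of_abs_le (hb w)))
  calc ∫ w, Real.exp (X w) ∂μ ≤ ∫ w, (1 + X w + X w ^ 2) ∂μ := by
        refine integral_mono hXe (((integrable_const 1).add hXi).add hX2) fun w => ?_
        have := (abs_le.1 (Real.abs_exp_sub_one_sub_id_le (hb w))).2
        simp only
        linarith
    _ = (∫ w, X w ∂μ + ∫ w, X w ^ 2 ∂μ) + 1 := by
        have h1X : Integrable (fun w => 1 + X w) μ := (integrable_const 1).add hXi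
        rw [integral_add h1X hX2, integral_add (integrable_const 1) hXi]
        simp
        ring
    _ ≤ _ := Real.add_one_le_exp _

theorem integral_exp_sum_le {E : Type*} [MeasurableSpace E] (μ : Measure E)
    [IsProbabilityMeasure μ] {X : E → ℝ} (hX : Measurable X) (hb : ∀ w, |X w| ≤ 1) {N : ℕ} :
    ∫ w, Real.exp (∑ k, X (w k)) ∂(Measure.pi fun _ : Fin N => μ) ≤
      Real.exp (N * ∫ w, X w ∂μ + N * ∫ w, X w ^ 2 ∂μ) := by
  simp_rw [Real.exp_sum]
  rw [integral_fintype_prod_eq_pow (fun w => Real.exp (X w)), Fintype.card_fin, ← mul_add,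
    Real.exp_nat_mul]
  exact pow_le_pow_left₀ (integral_nonneg fun _ => (Real.exp_pos _).le) (integral_exp_le μ hX hb) N

/-- Reduces the modulus to four real linear forms: `|v| ≤ |Re v| + |Im v|`, followed by midpoint
convexity of `cosh`. The latter is the reason for the factor 1/2. -/
theorem cosh_half_norm_le (v : ℂ) :
    Real.cosh (‖v‖ / 2) ≤ (Real.exp v.re + Real.exp (-v.re) + Real.exp v.im +
      Real.exp (-v.im)) / 4 := by
  have h1 : ‖v‖ ≤ |v.re| + |v.im| := Complex.norm_le_abs_re_add_abs_im v
  have h2 : Real.cosh (‖v‖ / 2) ≤ Real.cosh ((|v.re| + |v.im|) / 2) := by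
    rw [Real.cosh_le_cosh, abs_of_nonneg (by positivity), abs_of_nonneg (by positivity)]
    linarith
  have key : ∀ a b : ℝ, Real.cosh ((a + b) / 2) ≤ (Real.cosh a + Real.cosh b) / 2 := by
    intro a b
    have e1 : a = (a + b) / 2 + (a - b) / 2 := by ring
    have e2 : b = (a + b) / 2 - (a - b) / 2 := by ring
    have h : Real.cosh a + Real.cosh b
        = 2 * (Real.cosh ((a + b) / 2) * Real.cosh ((a - b) / 2)) := by
      conv_lhs => rw [e1, e2]
      rw [Real.cosh_add, Real.cosh_sub]
      ring_nf
    rw [h]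
    nlinarith [Real.one_le_cosh ((a - b) / 2), Real.cosh_pos ((a + b) / 2)]
  have h3 := key |v.re| |v.im|
  rw [Real.cosh_abs, Real.cosh_abs, Real.cosh_eq v.re, Real.cosh_eq v.im] at h3
  linarith

/-- The exponent 2 is 1 for the total second moment plus 1 for the bias, the distance from the mean
of the sum to `q`. -/
theorem integral_exp_re_sum_le {E : Type*} [MeasurableSpace E] (μ : Measure E)
    [IsProbabilityMeasure μ] {N : ℕ} {z : E → ℂ} (hz : Measurable z) (hb : ∀ w, ‖z w‖ ≤ 1)
    (h2 : N * ∫ w, ‖z w‖ ^ 2 ∂μ ≤ 1) {q : ℂ} (hq : ‖N * ∫ w, z w ∂μ - q‖ ≤ 1) :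
    ∫ w, Real.exp (∑ k, z (w k) - q).re ∂(Measure.pi fun _ : Fin N => μ) ≤ Real.exp 2 := by
  have hzi : Integrable z μ := Integrable.of_bound hz.aestronglyMeasurable 1 (.of_forall hb)
  have hre : Measurable fun w => (z w).re := Complex.measurable_re.comp hz
  have hreb : ∀ w, |(z w).re| ≤ 1 := fun w => (Complex.abs_re_le_norm _).trans (hb w)
  have hmean : ∫ w, (z w).re ∂μ = (∫ w, z w ∂μ).re := integral_re hzi
  have hsq : ∫ w, (z w).re ^ 2 ∂μ ≤ ∫ w, ‖z w‖ ^ 2 ∂μ := by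
    refine integral_mono (Integrable.of_bound (hre.pow_const 2).aestronglyMeasurable 1
        (.of_forall fun w => by simpa using hreb w))
      (Integrable.of_bound (hz.norm.pow_const 2).aestronglyMeasurable 1
        (.of_forall fun w => by simpa using hb w)) fun w => ?_
    exact sq_le_sq.2 (by simpa using Complex.abs_re_le_norm (z w))
  have hq' := (Complex.abs_re_le_norm _).trans hq
  calc ∫ w, Real.exp (∑ k, z (w k) - q).re ∂(Measure.pi fun _ : Fin N => μ)
      = Real.exp (-q.re) * ∫ w, Real.exp (∑ k, (z (w k)).re)
          ∂(Measure.pi fun _ : Fin N => μ) := by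
        rw [← integral_const_mul]
        congr 1 with w
        rw [← Real.exp_add, Complex.sub_re, Complex.re_sum]
        ring_nf
    _ ≤ Real.exp (-q.re) * Real.exp (N * ∫ w, (z w).re ∂μ + N * ∫ w, (z w).re ^ 2 ∂μ) := by
        gcongr
        exact integral_exp_sum_le μ hre hreb
    _ ≤ Real.exp 2 := by
        rw [← Real.exp_add, Real.exp_le_exp, hmean]
        have h3 : (N : ℝ) * ∫ w, (z w).re ^ 2 ∂μ ≤ 1 := le_trans (by gcongr) h2
        have h4 := (abs_le.1 hq').2
        simp only [Complex.sub_re, Complex.mul_re, Complex.natCast_re, Complex.natCast_im, zero_mul,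
          sub_zero] at h4
        linarith

theorem norm_sum_sub_le {N : ℕ} {v : Fin N → ℂ} (hv : ∀ k, ‖v k‖ ≤ 1) {q : ℂ}
    (hq : ‖q‖ ≤ N + 1) : ‖∑ k, v k - q‖ ≤ 2 * N + 1 := by
  have : ‖∑ k, v k‖ ≤ N := by
    simpa using norm_sum_le_of_le (n := fun _ => (1 : ℝ)) Finset.univ fun k _ => hv k
  linarith [norm_sub_le (∑ k, v k) q]

theorem norm_le_of_mean_close {E : Type*} [MeasurableSpace E] (μ : Measure E)
    [IsProbabilityMeasure μ] {N : ℕ} {z : E → ℂ} (hb : ∀ w, ‖z w‖ ≤ 1)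
    {q : ℂ} (hq : ‖N * ∫ w, z w ∂μ - q‖ ≤ 1) : ‖q‖ ≤ N + 1 := by
  have h1 : ‖∫ w, z w ∂μ‖ ≤ 1 := by
    simpa using norm_integral_le_of_norm_le_const (μ := μ) (.of_forall hb)
  have h2 : ‖(N : ℂ) * ∫ w, z w ∂μ‖ ≤ N := by
    rw [norm_mul, Complex.norm_natCast]
    exact mul_le_of_le_one_right (Nat.cast_nonneg N) h1
  have h3 := norm_sub_norm_le q (N * ∫ w, z w ∂μ)
  rw [norm_sub_rev] at h3
  linarith

/-- The hypotheses are invariant under multiplying `z` and `q` by a unit complex number, so the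
bound on the real part applies to the rotations by `±1` and `±i`. -/
theorem integral_cosh_half_norm_le {E : Type*} [MeasurableSpace E] (μ : Measure E)
    [IsProbabilityMeasure μ] {N : ℕ} {z : E → ℂ} (hz : Measurable z) (hb : ∀ w, ‖z w‖ ≤ 1)
    (h2 : N * ∫ w, ‖z w‖ ^ 2 ∂μ ≤ 1) {q : ℂ} (hq : ‖N * ∫ w, z w ∂μ - q‖ ≤ 1) :
    ∫ w, Real.cosh (‖∑ k, z (w k) - q‖ / 2) ∂(Measure.pi fun _ : Fin N => μ) ≤ Real.exp 2 := by
  have hrot : ∀ u : ℂ, ‖u‖ = 1 →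
      Integrable (fun w => Real.exp (u * (∑ k, z (w k) - q)).re) (Measure.pi fun _ : Fin N => μ) ∧
      ∫ w, Real.exp (u * (∑ k, z (w k) - q)).re ∂(Measure.pi fun _ : Fin N => μ) ≤ Real.exp 2 := by
    intro u hu
    constructor
    · refine Integrable.of_bound (by fun_prop) (Real.exp (2 * N + 1)) (.of_forall fun w => ?_)
      rw [Real.norm_eq_abs, Real.abs_exp, Real.exp_le_exp]
      refine (le_abs_self _).trans ((Complex.abs_re_le_norm _).trans ?_)
      rw [norm_mul, hu, one_mul]
      exact norm_sum_sub_le (fun k => hb (w k)) (norm_le_of_mean_close μ hb hq)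
    · have := integral_exp_re_sum_le μ (N := N) (z := fun w => u * z w) (hz.const_mul u)
        (fun w => by simpa [hu] using hb w) (by simpa [hu] using h2) (q := u * q) (by
          rw [integral_const_mul, mul_left_comm, ← mul_sub, norm_mul, hu, one_mul]
          exact hq)
      simpa only [mul_sub, Finset.mul_sum] using this
  obtain ⟨i1, b1⟩ := hrot 1 (by simp)
  obtain ⟨i2, b2⟩ := hrot (-1) (by simp)
  obtain ⟨i3, b3⟩ := hrot (-Complex.I) (by simp)
  obtain ⟨i4, b4⟩ := hrot Complex.I (by simp)
  have hle : ∀ w : Fin N → E, Real.cosh (‖∑ k, z (w k) - q‖ / 2) ≤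
      (Real.exp (1 * (∑ k, z (w k) - q)).re + Real.exp (-1 * (∑ k, z (w k) - q)).re
        + Real.exp (-Complex.I * (∑ k, z (w k) - q)).re
        + Real.exp (Complex.I * (∑ k, z (w k) - q)).re) / 4 := by
    intro w
    convert cosh_half_norm_le (∑ k, z (w k) - q) using 6 <;> simp
  have hint := (((i1.add i2).add i3).add i4).div_const 4
  refine (integral_mono_of_nonneg (.of_forall fun w => (Real.cosh_pos _).le) hint
    (.of_forall hle)).trans ?_
  rw [integral_div]
  have s1 := integral_add i1 i2
  have s2 := integral_add (i1.add i2) i3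
  have s3 := integral_add ((i1.add i2).add i3) i4
  simp only [Pi.add_apply] at s1 s2 s3 ⊢
  linarith

/-- Jensen for `cosh ∘ √` bounds `cosh` of half the `L²(τ)` norm by the `τ`-average of the pointwise
`cosh`. Fubini bounds the expectation of that average by `e²`, and Markov gives the tail. -/
theorem measure_lt_avg_sq_le {E 𝒳 : Type*} [MeasurableSpace E] [MeasurableSpace 𝒳]
    (μ : Measure E) [IsProbabilityMeasure μ] (τ : Measure 𝒳) [IsProbabilityMeasure τ] {N : ℕ}
    {z : E → 𝒳 → ℂ} (hz : Measurable (Function.uncurry z)) (hb : ∀ w x, ‖z w x‖ ≤ 1)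
    (h2 : ∀ x, N * ∫ w, ‖z w x‖ ^ 2 ∂μ ≤ 1) {q : 𝒳 → ℂ} (hqm : Measurable q)
    (hq : ∀ x, ‖N * ∫ w, z w x ∂μ - q x‖ ≤ 1) {R : ℝ} (hR : 0 ≤ R) :
    (Measure.pi fun _ : Fin N => μ) {w | R ^ 2 < ∫ x, ‖∑ k, z (w k) x - q x‖ ^ 2 ∂τ} ≤
      ENNReal.ofReal (Real.exp 2 / Real.cosh (R / 2)) := by
  set π := Measure.pi fun _ : Fin N => μ with hπ
  set Y : (Fin N → E) → 𝒳 → ℂ := fun w x => ∑ k, z (w k) x - q x with hY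
  have hYm : Measurable (Function.uncurry Y) := by
    refine Measurable.sub (Finset.measurable_sum _ fun k _ => ?_) (hqm.comp measurable_snd)
    have hk : Measurable fun p : (Fin N → E) × 𝒳 => (p.1 k, p.2) := by fun_prop
    exact hz.comp hk
  have hYm' : ∀ w, Measurable (Y w) := fun w => hYm.comp measurable_prodMk_left
  have hYb : ∀ w x, ‖Y w x‖ ≤ 2 * N + 1 := fun w x =>
    norm_sum_sub_le (fun k => hb (w k) x)
      (norm_le_of_mean_close μ (fun w => hb w x) (hq x))
  have hcb : ∀ w x, ‖Real.cosh (‖Y w x‖ / 2)‖ ≤ Real.cosh ((2 * N + 1) / 2) := by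
    intro w x
    rw [Real.norm_of_nonneg (Real.cosh_pos _).le, Real.cosh_le_cosh, abs_of_nonneg (by positivity),
      abs_of_nonneg (by positivity)]
    linarith [hYb w x]
  have hcm : Measurable (Function.uncurry fun w x => Real.cosh (‖Y w x‖ / 2)) :=
    Real.measurable_cosh.comp (hYm.norm.div_const 2)
  have hci : Integrable (Function.uncurry fun w x => Real.cosh (‖Y w x‖ / 2)) (π.prod τ) :=
    Integrable.of_bound hcm.aestronglyMeasurable _ (.of_forall fun p => hcb p.1 p.2)
  have hjensen : ∀ w, Real.cosh (Real.sqrt (∫ x, ‖Y w x‖ ^ 2 ∂τ) / 2) ≤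
      ∫ x, Real.cosh (‖Y w x‖ / 2) ∂τ := by
    intro w
    have hfun : ∀ x, Real.cosh (Real.sqrt (‖Y w x‖ ^ 2 / 4)) = Real.cosh (‖Y w x‖ / 2) := by
      intro x
      rw [show ‖Y w x‖ ^ 2 / 4 = (‖Y w x‖ / 2) ^ 2 by ring, Real.sqrt_sq (by positivity)]
    have := convexOn_cosh_sqrt.map_integral_le (μ := τ) (f := fun x => ‖Y w x‖ ^ 2 / 4)
      (Real.continuous_cosh.comp Real.continuous_sqrt).continuousOn isClosed_Ici
      (.of_forall fun x => by simp only [Set.mem_Ici]; positivity)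
      (Integrable.of_bound (((hYm' w).norm.pow_const 2).div_const 4).aestronglyMeasurable
        ((2 * N + 1) ^ 2 / 4) (.of_forall fun x => by
          rw [Real.norm_of_nonneg (by positivity)]
          gcongr
          exact hYb w x))
      (by
        simp only [Function.comp_def, hfun]
        exact Integrable.of_bound
          (Real.measurable_cosh.comp ((hYm' w).norm.div_const 2)).aestronglyMeasurable _
          (.of_forall (hcb w)))
    simp only [hfun, integral_div] at this
    rwa [show (∫ x, ‖Y w x‖ ^ 2 ∂τ) / 4 = (∫ x, ‖Y w x‖ ^ 2 ∂τ) / 2 ^ 2 by norm_num,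
      Real.sqrt_div' _ (by positivity), Real.sqrt_sq (by positivity)] at this
  have hmean : ∫ w, ∫ x, Real.cosh (‖Y w x‖ / 2) ∂τ ∂π ≤ Real.exp 2 := by
    rw [integral_integral_swap hci]
    calc ∫ x, ∫ w, Real.cosh (‖Y w x‖ / 2) ∂π ∂τ ≤ ∫ _, Real.exp 2 ∂τ := by
          refine integral_mono hci.integral_prod_right (integrable_const _) fun x => ?_
          exact integral_cosh_half_norm_le μ (hz.comp measurable_prodMk_right)
            (fun w => hb w x) (h2 x) (hq x)
      _ = Real.exp 2 := by simp
  have hsub : {w | R ^ 2 < ∫ x, ‖Y w x‖ ^ 2 ∂τ} ⊆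
      {w | Real.cosh (R / 2) ≤ ∫ x, Real.cosh (‖Y w x‖ / 2) ∂τ} := by
    intro w hw
    refine le_trans ?_ (hjensen w)
    rw [Real.cosh_le_cosh, abs_of_nonneg (by positivity), abs_of_nonneg (by positivity)]
    have : R ≤ Real.sqrt (∫ x, ‖Y w x‖ ^ 2 ∂τ) := Real.le_sqrt_of_sq_le (le_of_lt hw)
    linarith
  refine (measure_mono hsub).trans ?_
  rw [← ofReal_measureReal]
  refine ENNReal.ofReal_le_ofReal ?_
  rw [le_div_iff₀ (Real.cosh_pos _), mul_comm]
  exact (mul_meas_ge_le_integral_of_nonneg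
    (.of_forall fun w => integral_nonneg fun x => (Real.cosh_pos _).le)
    hci.integral_prod_left _).trans hmean

/-! ### Truncation and the Monte Carlo error -/

open Classical in
/-- The truncation `a · 𝟙_{|a| ≤ T}`. -/
noncomputable def truncate (T : ℝ) (a : ℂ) : ℂ := if ‖a‖ ≤ T then a else 0

theorem norm_truncate_le {T : ℝ} (hT : 0 ≤ T) (a : ℂ) : ‖truncate T a‖ ≤ T := by
  unfold truncate
  split_ifs with h
  · exact h
  · simpa using hT

theorem norm_truncate_le_norm (T : ℝ) (a : ℂ) : ‖truncate T a‖ ≤ ‖a‖ := by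
  unfold truncate
  split_ifs with h <;> simp

/-- Controls the truncation bias by the second moment: a value is changed only when it exceeds `T`
in modulus. -/
theorem mul_norm_truncate_sub_le {T : ℝ} (a : ℂ) : T * ‖truncate T a - a‖ ≤ ‖a‖ ^ 2 := by
  unfold truncate
  split_ifs with h
  · simp
  · rw [zero_sub, norm_neg, sq]
    exact mul_le_mul_of_nonneg_right (not_le.1 h).le (norm_nonneg a)

theorem measurable_truncate (T : ℝ) : Measurable (truncate T) :=
  Measurable.ite (measurableSet_le measurable_norm measurable_const) measurable_id measurable_const

theorem I₁_eq (F : ℝ) (N : ℕ) (δ : ℝ) : I₁ F N δ =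
    F ^ 2 / N * (2 + 32 * Real.log (2 / δ) ^ 2 + 4 * Real.log (2 / δ)) := by
  unfold I₁
  ring

theorem log_two_le_log_two_div {δ : ℝ} (hδ : 0 < δ) (hδ1 : δ < 1) :
    Real.log 2 ≤ Real.log (2 / δ) := by
  apply Real.log_le_log (by norm_num)
  rw [le_div_iff₀ hδ]
  linarith

theorem four_thirds_le_log {δ : ℝ} (hδ : 0 < δ) (hδ5 : δ < 1 / 5) :
    4 / 3 ≤ Real.log (2 / δ) := by
  rw [Real.le_log_iff_exp_le (by positivity)]
  have h1 : Real.exp (4 / 3) ≤ Real.exp 1 ^ 2 := by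
    rw [← Real.exp_nat_mul]
    exact Real.exp_le_exp.2 (by norm_num)
  have h2 : Real.exp 1 ^ 2 ≤ 10 := by nlinarith [Real.exp_one_lt_d9, Real.exp_pos 1]
  refine h1.trans (h2.trans ?_)
  rw [le_div_iff₀ hδ]
  linarith

/-- With `l = log (2/δ)` one has `R/2 - l ≥ 3l/2 ≥ 2`; this is where `l ≥ 4/3` enters. -/
theorem exp_two_div_cosh_le {δ R : ℝ} (hδ : 0 < δ) (hδ5 : δ < 1 / 5)
    (hR : 5 * Real.log (2 / δ) ≤ R) : Real.exp 2 / Real.cosh (R / 2) ≤ δ := by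
  have hl := four_thirds_le_log hδ hδ5
  set l := Real.log (2 / δ) with hldef
  have hδl : δ = 2 * Real.exp (-l) := by
    rw [hldef, Real.exp_neg, Real.exp_log (by positivity)]
    field_simp
  rw [div_le_iff₀ (Real.cosh_pos _), hδl, Real.cosh_eq]
  have h1 : Real.exp 2 ≤ Real.exp (-l) * Real.exp (R / 2) := by
    rw [← Real.exp_add, Real.exp_le_exp]
    linarith
  nlinarith [Real.exp_pos (-l), Real.exp_pos (-(R / 2))]

/-- The mean square error of the truncated Monte Carlo approximation of the function
`x ↦ ∫ β(w) e(w, x) dμ(w)`. -/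
theorem measure_I₁_lt_le {E 𝒳 : Type*} [MeasurableSpace E] [MeasurableSpace 𝒳]
    (μ : Measure E) [IsProbabilityMeasure μ] (τ : Measure 𝒳) [IsProbabilityMeasure τ] {N : ℕ}
    (hN : 0 < N) {β : E → ℂ} (hβ : Measurable β) (hβ2 : Integrable (fun w => ‖β w‖ ^ 2) μ)
    {e : E → 𝒳 → ℂ} (he : Measurable fun r : E × 𝒳 => e r.1 r.2) (heb : ∀ w x, ‖e w x‖ ≤ 1)
    {F δ : ℝ} (hF0 : 0 ≤ F) (hF : ∫ w, ‖β w‖ ^ 2 ∂μ = F ^ 2) (hδ : 0 < δ) (hδ5 : δ < 1 / 5) :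
    (Measure.pi fun _ : Fin N => μ) {w | I₁ F N δ < ∫ x,
      ‖(N : ℂ)⁻¹ * ∑ k, truncate (F * Real.sqrt N) (β (w k)) * e (w k) x
        - ∫ v, β v * e v x ∂μ‖ ^ 2 ∂τ} ≤ ENNReal.ofReal δ := by
  have hN' : (0 : ℝ) < N := by exact_mod_cast hN
  have hl := four_thirds_le_log hδ hδ5
  have hem : ∀ x, Measurable fun w => e w x := fun x => he.comp measurable_prodMk_right
  have hβi : Integrable β μ :=
    ((memLp_two_iff_integrable_sq_norm hβ.aestronglyMeasurable).2 hβ2).integrable one_le_two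
  have hint : ∀ x, Integrable (fun v => β v * e v x) μ := fun x =>
    hβi.mul_bdd (c := 1) (hem x).aestronglyMeasurable (.of_forall fun v => heb v x)
  -- If `F = 0` the level `T` is 0 and cannot be divided by, but then `β = 0` almost everywhere and
  -- the error vanishes almost surely.
  rcases hF0.eq_or_lt with rfl | hFpos
  · have hae : β =ᵐ[μ] 0 := by
      have := (integral_eq_zero_iff_of_nonneg (fun w => sq_nonneg ‖β w‖) hβ2).1 (by simpa using hF)
      filter_upwards [this] with w hw
      simpa using hw
    have hint0 : ∀ x, ∫ v, β v * e v x ∂μ = 0 := fun x =>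
      integral_eq_zero_of_ae (by filter_upwards [hae] with w hw; simp [hw])
    have hall : ∀ᵐ w ∂(Measure.pi fun _ : Fin N => μ), ∀ k, β (w k) = 0 :=
      ae_all_iff.2 fun k => (Measure.tendsto_eval_ae_ae (μ := fun _ : Fin N => μ)).eventually hae
    refine le_of_eq_of_le (measure_eq_zero_iff_ae_notMem.2 ?_) zero_le
    filter_upwards [hall] with w hw
    simp [hw, hint0, truncate, I₁]
  -- Dividing by this level makes the sup bound, the total second moment `N F² / T²` and the bias
  -- bound `(N / T)(F² / T)` all equal to 1.
  set T := F * Real.sqrt N with hT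
  have hTpos : 0 < T := by positivity
  have hT2 : T ^ 2 = F ^ 2 * N := by rw [hT, mul_pow, Real.sq_sqrt hN'.le]
  set l := Real.log (2 / δ)
  -- Chosen so that `I₁ = R² F² / N`; the bound `R ≥ 5 l` follows from `32 ≥ 25`.
  set R := Real.sqrt (2 + 32 * l ^ 2 + 4 * l) with hR
  have hR5 : 5 * l ≤ R := Real.le_sqrt_of_sq_le (by nlinarith)
  let z : E → 𝒳 → ℂ := fun w x => truncate T (β w) * e w x / T
  let q : 𝒳 → ℂ := fun x => N / T * ∫ v, β v * e v x ∂μ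
  have htm : Measurable fun w => truncate T (β w) := (measurable_truncate T).comp hβ
  have hz : Measurable (Function.uncurry z) :=
    ((htm.comp measurable_fst).mul he).div_const _
  have hnorm : ∀ w x, ‖truncate T (β w) * e w x‖ ≤ ‖truncate T (β w)‖ := fun w x => by
    rw [norm_mul]
    exact mul_le_of_le_one_right (norm_nonneg _) (heb w x)
  have hzn : ∀ w x, ‖z w x‖ = ‖truncate T (β w) * e w x‖ / T := fun w x => by
    simp only [z]
    rw [norm_div, Complex.norm_real, Real.norm_of_nonneg hTpos.le]
  have hb : ∀ w x, ‖z w x‖ ≤ 1 := fun w x => by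
    rw [hzn, div_le_one hTpos]
    exact (hnorm w x).trans (norm_truncate_le hTpos.le _)
  have h2 : ∀ x, N * ∫ w, ‖z w x‖ ^ 2 ∂μ ≤ 1 := by
    intro x
    have : ∫ w, ‖z w x‖ ^ 2 ∂μ ≤ ∫ w, ‖β w‖ ^ 2 / T ^ 2 ∂μ := by
      refine integral_mono_of_nonneg (.of_forall fun w => by positivity) (hβ2.div_const _)
        (.of_forall fun w => ?_)
      simp only [hzn, div_pow]
      gcongr
      exact (hnorm w x).trans (norm_truncate_le_norm _ _)
    rw [integral_div, hF, hT2] at this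
    calc N * ∫ w, ‖z w x‖ ^ 2 ∂μ ≤ N * (F ^ 2 / (F ^ 2 * N)) := by gcongr
      _ = 1 := by field_simp
  have hqm : Measurable q := by
    refine Measurable.const_mul (StronglyMeasurable.measurable ?_) _
    refine StronglyMeasurable.integral_prod_right (f := fun x v => β v * e v x) (ν := μ) ?_
    exact ((hβ.comp measurable_snd).mul (he.comp measurable_swap)).stronglyMeasurable
  have htint : ∀ x, Integrable (fun v => truncate T (β v) * e v x) μ := fun x =>
    Integrable.of_bound (htm.mul (hem x)).aestronglyMeasurable T
      (.of_forall fun w => (hnorm w x).trans (norm_truncate_le hTpos.le _))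
  have hq : ∀ x, ‖N * ∫ w, z w x ∂μ - q x‖ ≤ 1 := by
    intro x
    have h3 : N * ∫ w, z w x ∂μ - q x = N / T * ∫ w, (truncate T (β w) - β w) * e w x ∂μ := by
      simp only [z, q, integral_div, sub_mul]
      rw [integral_sub (htint x) (hint x)]
      ring
    have h4 : ‖∫ w, (truncate T (β w) - β w) * e w x ∂μ‖ ≤ F ^ 2 / T := by
      rw [← hF, ← integral_div]
      refine norm_integral_le_of_norm_le (hβ2.div_const T) (.of_forall fun w => ?_)
      rw [norm_mul, le_div_iff₀ hTpos, mul_comm]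
      refine le_trans ?_ (mul_norm_truncate_sub_le (T := T) (β w))
      gcongr
      exact mul_le_of_le_one_right (norm_nonneg _) (heb w x)
    rw [h3, norm_mul, norm_div, Complex.norm_natCast, Complex.norm_real,
      Real.norm_of_nonneg hTpos.le]
    calc N / T * ‖∫ w, (truncate T (β w) - β w) * e w x ∂μ‖ ≤ N / T * (F ^ 2 / T) := by gcongr
      _ = F ^ 2 * N / T ^ 2 := by ring
      _ = 1 := by rw [← hT2]; exact div_self (by positivity)
  refine le_trans (le_of_eq ?_) ((measure_lt_avg_sq_le μ τ hz hb h2 hqm hq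
    (R := R) (Real.sqrt_nonneg _)).trans
    (ENNReal.ofReal_le_ofReal (exp_two_div_cosh_le hδ hδ5 hR5)))
  congr 1
  ext w
  have hterm : ∀ x, ‖∑ k, z (w k) x - q x‖ ^ 2 = N / F ^ 2 *
      ‖(N : ℂ)⁻¹ * ∑ k, truncate T (β (w k)) * e (w k) x - ∫ v, β v * e v x ∂μ‖ ^ 2 := by
    intro x
    have h5 : ∑ k, z (w k) x - q x = (N / T : ℂ) *
        ((N : ℂ)⁻¹ * ∑ k, truncate T (β (w k)) * e (w k) x - ∫ v, β v * e v x ∂μ) := by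
      have : (N : ℂ) ≠ 0 := by exact_mod_cast hN.ne'
      simp only [z, q, ← Finset.sum_div]
      field_simp
    rw [h5, norm_mul, mul_pow, norm_div, Complex.norm_natCast, Complex.norm_real,
      Real.norm_of_nonneg hTpos.le, div_pow, hT2]
    congr 1
    field_simp

  simp_rw [Set.mem_ofPred_eq, hterm]
  rw [integral_const_mul, I₁_eq, hR, Real.sq_sqrt (by positivity), ← div_lt_iff₀' (by positivity)]
  rw [div_div_eq_mul_div, mul_comm, ← mul_div_assoc]

/-! ### Minimum-norm interpolation -/

theorem exists_mulVec_eq_of_det_ne_zero {m N : ℕ} (A : Matrix (Fin m) (Fin N) ℂ)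
    (g : Fin m → Fin N) (hA : (A.submatrix id g).det ≠ 0) (y : Fin m → ℂ) :
    ∃ c : Fin N → ℂ, A.mulVec c = y := by
  have hu : IsUnit (A.submatrix id g).det := hA.isUnit
  refine ⟨∑ i, Pi.single (g i) (((A.submatrix id g)⁻¹.mulVec y) i), ?_⟩
  have h : (A.submatrix id g).mulVec ((A.submatrix id g)⁻¹.mulVec y) = y := by
    rw [Matrix.mulVec_mulVec, Matrix.mul_nonsing_inv _ hu, Matrix.one_mulVec]
  rw [Matrix.mulVec_sum]
  conv_rhs => rw [← h]
  ext j
  simp [Matrix.mulVec, dotProduct]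

/-- The minimizer is the component of any solution orthogonal to the kernel; Pythagoras gives
minimality and uniqueness together. -/
theorem existsUnique_isMinNormSolution {m N : ℕ} (A : Matrix (Fin m) (Fin N) ℂ) (y : Fin m → ℂ)
    (hy : ∃ c : Fin N → ℂ, A.mulVec c = y) : ∃! c, IsMinNormSolution A y c := by
  obtain ⟨c₀, hc₀⟩ := hy
  let l : EuclideanSpace ℂ (Fin N) →ₗ[ℂ] (Fin m → ℂ) :=
    A.mulVecLin ∘ₗ (WithLp.linearEquiv 2 ℂ (Fin N → ℂ)).toLinearMap
  let V := LinearMap.ker l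
  have hl : ∀ c : EuclideanSpace ℂ (Fin N), l c = A.mulVec c.ofLp := fun c => rfl
  set b : EuclideanSpace ℂ (Fin N) := WithLp.toLp 2 c₀ with hb
  set c := b - V.starProjection b with hc
  have hcV : c ∈ Vᗮ := V.sub_starProjection_mem_orthogonal b
  have hcy : l c = y := by
    have : l (V.starProjection b) = 0 := V.starProjection_apply_mem b
    rw [hc, map_sub, this, sub_zero, hl]
    exact hc₀
  have hpyth : ∀ c', l c' = y → ‖c'‖ * ‖c'‖ = ‖c‖ * ‖c‖ + ‖c' - c‖ * ‖c' - c‖ := by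
    intro c' hc'
    have hmem : c' - c ∈ V := by
      rw [LinearMap.mem_ker, map_sub, hc', hcy, sub_self]
    have := norm_add_sq_eq_norm_sq_add_norm_sq_of_inner_eq_zero (𝕜 := ℂ) c (c' - c)
      (V.inner_left_of_mem_orthogonal hmem hcV)
    rwa [add_sub_cancel] at this
  refine ⟨c, ⟨hcy, fun c' hc' => ?_⟩, fun c' hc' => ?_⟩
  · have := hpyth c' hc'
    nlinarith [norm_nonneg c, norm_nonneg c', mul_self_nonneg ‖c' - c‖]
  · have h1 := hpyth c' hc'.1
    have h2 := hc'.2 c hcy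
    have h3 : ‖c' - c‖ * ‖c' - c‖ = 0 := by
      nlinarith [norm_nonneg c, norm_nonneg c', mul_self_nonneg ‖c' - c‖]
    exact sub_eq_zero.1 (norm_eq_zero.1 (mul_self_eq_zero.1 h3))

/-! ### Ball volumes, fill distance and the Lipschitz covering argument -/

theorem exists_unitBall_const_le :
    ∃ M : ℝ, ∀ d : ℕ, Real.sqrt Real.pi ^ d / Real.Gamma (d / 2 + 1) ≤ M := by
  set v : ℕ → ℝ := fun d => Real.sqrt Real.pi ^ d / Real.Gamma (d / 2 + 1) with hv
  have hpos : ∀ d, 0 ≤ v d := fun d =>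
    div_nonneg (by positivity) (Real.Gamma_pos_of_pos (by positivity)).le
  have hrec : ∀ d : ℕ, v (d + 2) = v d * (2 * Real.pi / (d + 2)) := by
    intro d
    have h1 : ((d + 2 : ℕ) : ℝ) / 2 + 1 = ((d : ℝ) / 2 + 1) + 1 := by push_cast; ring
    have hG : Real.Gamma ((d : ℝ) / 2 + 1) ≠ 0 := (Real.Gamma_pos_of_pos (by positivity)).ne'
    simp only [hv]
    rw [h1, Real.Gamma_add_one (by positivity), pow_add, Real.sq_sqrt Real.pi_pos.le]
    field_simp
  -- The ratio `v (e + 2) / v e = 2π / (e + 2)` is at most 1 once `e ≥ 6`, so the terms with index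
  -- below 8 dominate all others.
  refine ⟨∑ i ∈ Finset.range 8, v i, fun d => ?_⟩
  change v d ≤ _
  induction d using Nat.strong_induction_on with
  | _ d ih =>
    rcases lt_or_ge d 8 with hd | hd
    · exact Finset.single_le_sum (fun i _ => hpos i) (Finset.mem_range.2 hd)
    · obtain ⟨e, rfl⟩ : ∃ e, d = e + 2 := ⟨d - 2, by omega⟩
      rw [hrec]
      refine le_trans (mul_le_of_le_one_right (hpos e) ?_) (ih e (by omega))
      rw [div_le_one (by positivity)]
      have : (6 : ℝ) ≤ e := by exact_mod_cast (by omega : 6 ≤ e)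
      linarith [Real.pi_lt_four]

theorem exists_volume_closedBall_le :
    ∃ M : ℝ, 1 ≤ M ∧ ∀ (d : ℕ) (x : EuclideanSpace ℝ (Fin d)) (r : ℝ), 0 ≤ r →
      volume.real (Metric.closedBall x r) ≤ M * r ^ d := by
  obtain ⟨M, hM⟩ := exists_unitBall_const_le
  refine ⟨max M 1, le_max_right _ _, fun d x r hr => ?_⟩
  rcases Nat.eq_zero_or_pos d with rfl | hd
  · have huniv : Metric.closedBall x r = Set.univ := by
      ext y
      simp [Subsingleton.elim y x, hr]
    have hvol : volume.real (Set.univ : Set (EuclideanSpace ℝ (Fin 0))) = 1 := by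
      rw [measureReal_def, ← Set.preimage_univ (f := WithLp.ofLp),
        (PiLp.volume_preserving_ofLp (Fin 0)).measure_preimage MeasurableSet.univ.nullMeasurableSet,
        volume_pi, Measure.pi_of_empty]
      simp
    rw [huniv, hvol]
    simp
  · have : Nonempty (Fin d) := ⟨⟨0, hd⟩⟩
    rw [measureReal_def, EuclideanSpace.volume_closedBall, Fintype.card_fin, ENNReal.toReal_mul,
      ENNReal.toReal_pow, ENNReal.toReal_ofReal hr, mul_comm]
    gcongr
    rw [ENNReal.toReal_ofReal
      (div_nonneg (by positivity) (Real.Gamma_pos_of_pos (by positivity)).le)]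
    exact (hM d).trans (le_max_left _ _)

variable {d m : ℕ} {D : Set (EuclideanSpace ℝ (Fin d))} {X : Fin m → EuclideanSpace ℝ (Fin d)}

theorem fillDistance_nonneg : 0 ≤ fillDistance D X :=
  Real.iSup_nonneg fun _ => Real.iInf_nonneg fun _ => norm_nonneg _

theorem exists_norm_sub_le_fillDistance (hD : IsCompact D) (hm : 0 < m) (hX : ∀ j, X j ∈ D)
    {x : EuclideanSpace ℝ (Fin d)} (hx : x ∈ D) : ∃ j, ‖x - X j‖ ≤ fillDistance D X := by
  have : Nonempty (Fin m) := ⟨⟨0, hm⟩⟩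
  obtain ⟨j, hj⟩ := exists_eq_ciInf_of_finite (f := fun j : Fin m => ‖x - X j‖)
  refine ⟨j, hj.le.trans ?_⟩
  -- An unbounded real supremum would be 0 by convention; `diam D` bounds this one.
  refine le_ciSup (f := fun x : D => ⨅ j : Fin m, ‖(x : EuclideanSpace ℝ (Fin d)) - X j‖)
    ⟨Metric.diam D, ?_⟩ ⟨x, hx⟩
  rintro _ ⟨y, rfl⟩
  refine (ciInf_le (Set.finite_range _).bddBelow ⟨0, hm⟩).trans ?_
  rw [← dist_eq_norm]
  exact Metric.dist_le_diam_of_mem hD.isBounded y.2 (hX _)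

/-- The closed balls of radius `h` about the nodes cover `D`. On each, `|g|² ≤ 2 L² h² + 2 |g (X
j)|²`, and summing indicators of all the balls avoids choosing a partition. -/
theorem setIntegral_sq_le_of_lipschitz (hD : IsCompact D) (hm : 0 < m) (hX : ∀ j, X j ∈ D)
    {M : ℝ} (hM : ∀ (x : EuclideanSpace ℝ (Fin d)) (r : ℝ), 0 ≤ r →
      volume.real (Metric.closedBall x r) ≤ M * r ^ d)
    {g : EuclideanSpace ℝ (Fin d) → ℂ} {L : ℝ}
    (hg : ∀ x₁ ∈ D, ∀ x₂ ∈ D, ‖g x₁ - g x₂‖ ≤ L * ‖x₁ - x₂‖) (hL : 0 < L) :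
    ∫ x in D, ‖g x‖ ^ 2 ≤ 2 * L ^ 2 * fillDistance D X ^ 2 * volume.real D
      + 2 * M * fillDistance D X ^ d * ∑ j, ‖g (X j)‖ ^ 2 := by
  set h := fillDistance D X with hh
  have h0 : 0 ≤ h := fillDistance_nonneg
  have hfin : volume D ≠ ⊤ := hD.measure_lt_top.ne
  have hpt : ∀ x ∈ D, ‖g x‖ ^ 2 ≤ 2 * L ^ 2 * h ^ 2 +
      ∑ j, (Metric.closedBall (X j) h).indicator (fun _ => 2 * ‖g (X j)‖ ^ 2) x := by
    intro x hx
    obtain ⟨j, hj⟩ := exists_norm_sub_le_fillDistance hD hm hX hx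
    have h1 : ‖g x‖ ≤ L * h + ‖g (X j)‖ := by
      have h2 := hg x hx (X j) (hX j)
      have h3 := norm_sub_norm_le (g x) (g (X j))
      have h4 : L * ‖x - X j‖ ≤ L * h := by gcongr
      linarith
    have h5 : ‖g x‖ ^ 2 ≤ 2 * L ^ 2 * h ^ 2 + 2 * ‖g (X j)‖ ^ 2 := by
      have : ‖g x‖ ^ 2 ≤ (L * h + ‖g (X j)‖) ^ 2 := by gcongr
      nlinarith [sq_nonneg (L * h - ‖g (X j)‖)]
    refine h5.trans ((add_le_add_iff_left _).2 ?_)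
    have h6 : (Metric.closedBall (X j) h).indicator (fun _ => 2 * ‖g (X j)‖ ^ 2) x
        = 2 * ‖g (X j)‖ ^ 2 :=
      Set.indicator_of_mem (by rwa [Metric.mem_closedBall, dist_eq_norm]) _
    rw [← h6]
    exact Finset.single_le_sum
      (f := fun j => (Metric.closedBall (X j) h).indicator (fun _ => 2 * ‖g (X j)‖ ^ 2) x)
      (fun i _ => Set.indicator_nonneg (fun _ _ => by positivity) _) (Finset.mem_univ j)
  have hind : ∀ j, IntegrableOn
      ((Metric.closedBall (X j) h).indicator fun _ => 2 * ‖g (X j)‖ ^ 2) D := fun j =>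
    (integrableOn_const (C := 2 * ‖g (X j)‖ ^ 2) hfin).indicator
      Metric.isClosed_closedBall.measurableSet
  have hsum : IntegrableOn (fun x => ∑ j,
      (Metric.closedBall (X j) h).indicator (fun _ => 2 * ‖g (X j)‖ ^ 2) x) D :=
    integrable_finsetSum _ fun j _ => hind j
  have hconst : IntegrableOn (fun _ : EuclideanSpace ℝ (Fin d) => 2 * L ^ 2 * h ^ 2) D :=
    integrableOn_const hfin
  calc ∫ x in D, ‖g x‖ ^ 2
      ≤ ∫ x in D, (2 * L ^ 2 * h ^ 2 +
        ∑ j, (Metric.closedBall (X j) h).indicator (fun _ => 2 * ‖g (X j)‖ ^ 2) x) :=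
        integral_mono_of_nonneg (.of_forall fun x => by positivity) (Integrable.add hconst hsum)
          ((ae_restrict_mem hD.measurableSet).mono hpt)
    _ = 2 * L ^ 2 * h ^ 2 * volume.real D + ∑ j, ∫ x in D,
        (Metric.closedBall (X j) h).indicator (fun _ => 2 * ‖g (X j)‖ ^ 2) x := by
        rw [integral_add hconst hsum, integral_finsetSum _ fun j _ => hind j, setIntegral_const,
          smul_eq_mul, mul_comm (volume.real D)]
    _ ≤ 2 * L ^ 2 * h ^ 2 * volume.real D + ∑ j, M * h ^ d * (2 * ‖g (X j)‖ ^ 2) := by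
        gcongr with j
        rw [setIntegral_indicator Metric.isClosed_closedBall.measurableSet, setIntegral_const,
          smul_eq_mul]
        gcongr
        exact (measureReal_mono Set.inter_subset_right
          (isCompact_closedBall _ _).measure_lt_top.ne).trans (hM (X j) h h0)
    _ = _ := by
        rw [← Finset.mul_sum, ← Finset.mul_sum]
        ring

theorem setIntegral_sq_sub_le (hD : IsCompact D) {f g p : EuclideanSpace ℝ (Fin d) → ℂ}
    (hf : ContinuousOn f D) (hg : ContinuousOn g D) (hp : ContinuousOn p D) :
    ∫ x in D, ‖f x - p x‖ ^ 2 ≤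
      2 * (∫ x in D, ‖g x - f x‖ ^ 2) + 2 * ∫ x in D, ‖g x - p x‖ ^ 2 := by
  have i1 : IntegrableOn (fun x => 2 * ‖g x - f x‖ ^ 2) D :=
    (((hg.sub hf).norm.pow 2).integrableOn_compact hD).const_mul 2
  have i2 : IntegrableOn (fun x => 2 * ‖g x - p x‖ ^ 2) D :=
    (((hg.sub hp).norm.pow 2).integrableOn_compact hD).const_mul 2
  rw [← integral_const_mul, ← integral_const_mul, ← integral_add i1 i2]
  refine integral_mono_of_nonneg (.of_forall fun x => by positivity) (Integrable.add i1 i2)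
    (.of_forall fun x => ?_)
  have h1 : ‖f x - p x‖ ≤ ‖g x - f x‖ + ‖g x - p x‖ := by
    have := norm_sub_le (g x - p x) (g x - f x)
    rw [sub_sub_sub_cancel_left] at this
    linarith
  have h2 : ‖f x - p x‖ ^ 2 ≤ (‖g x - f x‖ + ‖g x - p x‖) ^ 2 := by gcongr
  simp only
  nlinarith [sq_nonneg (‖g x - f x‖ - ‖g x - p x‖)]

/-! ### The Cauchy law and the random feature model -/

section Law

variable {d : ℕ} {γ : ℝ≥0}

theorem density_pos (hγ : 0 < γ) (w : EuclideanSpace ℝ (Fin d)) : 0 < density γ w :=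
  Finset.prod_pos fun _ _ => cauchyPDF_pos 0 hγ.ne' _

theorem measurable_density : Measurable (density γ : EuclideanSpace ℝ (Fin d) → ℝ) := by
  refine Finset.measurable_prod _ fun j _ => (measurable_cauchyPDFReal 0 γ).comp ?_
  fun_prop

theorem continuous_feature :
    Continuous fun p : EuclideanSpace ℝ (Fin d) × EuclideanSpace ℝ (Fin d) =>
      feature p.1 p.2 := by
  unfold feature
  fun_prop

theorem measurable_feature_comp {𝒳 : Type*} [MeasurableSpace 𝒳]
    {p : 𝒳 → EuclideanSpace ℝ (Fin d)} (hp : Measurable p) :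
    Measurable fun r : EuclideanSpace ℝ (Fin d) × 𝒳 => feature r.1 (p r.2) := by
  unfold feature
  exact (measurable_fst.inner (hp.comp measurable_snd)).complex_ofReal.const_mul _ |>.cexp

theorem norm_feature (w x : EuclideanSpace ℝ (Fin d)) : ‖feature w x‖ = 1 := by
  rw [feature, mul_comm, Complex.norm_exp_ofReal_mul_I]

theorem integral_mul_feature_eq (hγ : 0 < γ) (fhat : EuclideanSpace ℝ (Fin d) → ℂ)
    (x : EuclideanSpace ℝ (Fin d)) :
    ∫ w, fhat w * feature w x = ∫ w, amplitude γ fhat w * feature w x ∂(law d γ) := by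
  rw [law, integral_withDensity_eq_integral_toReal_smul measurable_density.ennreal_ofReal
    (.of_forall fun _ => ENNReal.ofReal_lt_top)]
  congr 1 with w
  have h : (density γ w : ℂ) ≠ 0 := by exact_mod_cast (density_pos hγ w).ne'
  rw [ENNReal.toReal_ofReal (density_pos hγ w).le, amplitude, Complex.real_smul]
  field_simp

/-- Provides a continuous function on the whole space agreeing with `f` on `D`, hence the
integrability of all errors over `D`. -/
theorem continuous_integral_amplitude [IsProbabilityMeasure (law d γ)]
    {fhat : EuclideanSpace ℝ (Fin d) → ℂ} (hf : MemLp (amplitude γ fhat) 2 (law d γ)) :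
    Continuous fun x => ∫ w, amplitude γ fhat w * feature w x ∂(law d γ) := by
  have hi := hf.integrable one_le_two
  refine continuous_of_dominated (bound := fun w => ‖amplitude γ fhat w‖) (fun x => ?_)
    (fun x => .of_forall fun w => ?_) hi.norm (.of_forall fun w => ?_)
  · refine hi.aestronglyMeasurable.mul (Continuous.aestronglyMeasurable ?_)
    exact continuous_feature.comp (by fun_prop : Continuous fun w => (w, x))
  · rw [norm_mul, norm_feature, mul_one]
  · exact continuous_const.mul
      (continuous_feature.comp (by fun_prop : Continuous fun x => (w, x)))

theorem continuous_model {N : ℕ} (w : Fin N → EuclideanSpace ℝ (Fin d))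
    (c : EuclideanSpace ℂ (Fin N)) : Continuous (model w c) :=
  continuous_finsetSum _ fun k _ => continuous_const.mul
    (continuous_feature.comp (by fun_prop : Continuous fun x => (w k, x)))

theorem continuous_bestModel {N : ℕ} (fhat : EuclideanSpace ℝ (Fin d) → ℂ)
    (w : Fin N → EuclideanSpace ℝ (Fin d)) : Continuous (bestModel γ fhat w) :=
  continuous_const.mul (continuous_finsetSum _ fun k _ => continuous_const.mul
    (continuous_feature.comp (by fun_prop : Continuous fun x => (w k, x))))

/-- The map `p` allows one statement to serve both for points of `D` (`p = id`) and for node indices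
(`p = X`). The amplitude is replaced by a measurable representative, which almost surely agrees with
it at every sample. -/
theorem measure_I₁_lt_bestModel_le [IsProbabilityMeasure (law d γ)]
    {fhat : EuclideanSpace ℝ (Fin d) → ℂ} (hf : MemLp (amplitude γ fhat) 2 (law d γ))
    {N : ℕ} (hN : 0 < N) {𝒳 : Type*} [MeasurableSpace 𝒳] (τ : Measure 𝒳) [IsProbabilityMeasure τ]
    {p : 𝒳 → EuclideanSpace ℝ (Fin d)} (hp : Measurable p) {δ : ℝ} (hδ : 0 < δ)
    (hδ5 : δ < 1 / 5) :
    (Measure.pi fun _ : Fin N => law d γ) {w | I₁ (rhoNorm γ fhat) N δ < ∫ x,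
      ‖bestModel γ fhat w (p x)
        - ∫ v, amplitude γ fhat v * feature v (p x) ∂(law d γ)‖ ^ 2 ∂τ} ≤ ENNReal.ofReal δ := by
  obtain ⟨β, hβs, hae⟩ := hf.aestronglyMeasurable
  have hβ : Measurable β := hβs.measurable
  have hβ2 : Integrable (fun w => ‖β w‖ ^ 2) (law d γ) :=
    (memLp_two_iff_integrable_sq_norm hβ.aestronglyMeasurable).1 (hf.ae_eq hae)
  have hF : ∫ w, ‖β w‖ ^ 2 ∂(law d γ) = rhoNorm γ fhat ^ 2 := by
    rw [rhoNorm, Real.sq_sqrt (integral_nonneg fun _ => by positivity)]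
    exact integral_congr_ae (hae.mono fun w hw => by simp only [hw])
  have hall : ∀ᵐ w ∂(Measure.pi fun _ : Fin N => law d γ), ∀ k, amplitude γ fhat (w k) = β (w k) :=
    ae_all_iff.2 fun k =>
      (Measure.tendsto_eval_ae_ae (μ := fun _ : Fin N => law d γ)).eventually hae
  have h2 : ∀ x, ∫ v, amplitude γ fhat v * feature v (p x) ∂(law d γ)
      = ∫ v, β v * feature v (p x) ∂(law d γ) := fun x =>
    integral_congr_ae (hae.mono fun v hv => by simp only [hv])
  have key := measure_I₁_lt_le (law d γ) τ hN hβ hβ2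
    (e := fun w x => feature w (p x)) (measurable_feature_comp hp) (fun w x => (norm_feature w (p x)).le)
    (F := rhoNorm γ fhat) (Real.sqrt_nonneg _) hF hδ hδ5
  refine le_trans (measure_mono_ae (hall.mono fun w hw => ?_)) key
  have h1 : ∀ x, bestModel γ fhat w (p x) = (N : ℂ)⁻¹ * ∑ k,
      truncate (rhoNorm γ fhat * Real.sqrt N) (β (w k)) * feature (w k) (p x) := by
    intro x
    simp only [bestModel, truncatedAmplitude, truncate, hw]
  have h3 : ∫ x, ‖bestModel γ fhat w (p x)
        - ∫ v, amplitude γ fhat v * feature v (p x) ∂(law d γ)‖ ^ 2 ∂τ =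
      ∫ x, ‖(N : ℂ)⁻¹ * ∑ k,
        truncate (rhoNorm γ fhat * Real.sqrt N) (β (w k)) * feature (w k) (p x)
        - ∫ v, β v * feature v (p x) ∂(law d γ)‖ ^ 2 ∂τ := by
    simp only [h1, h2]
  exact fun h => lt_of_lt_of_eq h h3

end Law

/-! ### Transfer to the sample space, constants, and assembly -/

/-- The bad set `B` need not be measurable, so the good event is the complement of a measurable hull
of its preimage. -/
theorem exists_measurableSet_forall_notMem {Ω E : Type*} [MeasurableSpace Ω] [MeasurableSpace E]
    {P : Measure Ω} [IsProbabilityMeasure P] {μ : Measure E} {W : Ω → E} (hW : HasLaw W μ P)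
    {B : Set E} {ε : ℝ} (hε : 0 ≤ ε) (hB : μ B ≤ ENNReal.ofReal ε) :
    ∃ S, MeasurableSet S ∧ 1 - ε ≤ P.real S ∧ ∀ s ∈ S, W s ∉ B := by
  refine ⟨(toMeasurable P (W ⁻¹' B))ᶜ, (measurableSet_toMeasurable _ _).compl, ?_, fun s hs hB' =>
    hs (subset_toMeasurable _ _ hB')⟩
  rw [probReal_compl_eq_one_sub (measurableSet_toMeasurable _ _), measureReal_def,
    measure_toMeasurable]
  have h1 : P (W ⁻¹' B) ≤ ENNReal.ofReal ε := by
    refine le_trans (Measure.le_map_apply hW.aemeasurable B) ?_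
    rwa [hW.map_eq]
  have := ENNReal.toReal_le_of_le_ofReal hε h1
  linarith

theorem hasLaw_pi {Ω E : Type*} [MeasurableSpace Ω] [MeasurableSpace E] {P : Measure Ω}
    [IsProbabilityMeasure P] {μ : Measure E} {N : ℕ} {w : Fin N → Ω → E}
    (hw : ∀ k, HasLaw (w k) μ P) (hind : iIndepFun w P) :
    HasLaw (fun s k => w k s) (Measure.pi fun _ : Fin N => μ) P where
  aemeasurable := aemeasurable_pi_lambda _ fun k => (hw k).aemeasurable
  map_eq := by
    rw [(iIndepFun_iff_map_fun_eq_pi_map fun k => (hw k).aemeasurable).1 hind]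
    simp only [(hw _).map_eq]

/-- Here `η⁻² ≥ 4` and the logarithm is at least `log (5/2) ≥ 3/5`, so the coefficient of `m`
exceeds 1. -/
theorem le_of_sample_bound {m N : ℕ} {C η δ : ℝ} (hC : 1 ≤ C) (hm : 0 < m) (hη : 0 < η)
    (hη2 : η < 1 / 2) (hδ : 0 < δ) (hδ5 : δ < 1 / 5)
    (hN : C * (η ^ 2)⁻¹ * m * Real.log (m / (2 * δ)) ≤ N) : m ≤ N := by
  have hm1 : (1 : ℝ) ≤ m := by exact_mod_cast hm
  have h1 : 3 / 5 ≤ Real.log (m / (2 * δ)) := by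
    have h2 : (5 / 2 : ℝ) ≤ m / (2 * δ) := by
      rw [le_div_iff₀ (by positivity)]
      linarith
    have h3 := Real.one_sub_inv_le_log_of_pos (show (0 : ℝ) < 5 / 2 by norm_num)
    have h4 := Real.log_le_log (by norm_num) h2
    norm_num at h3
    linarith
  have h5 : 4 ≤ (η ^ 2)⁻¹ := by
    rw [le_inv_comm₀ (by norm_num) (by positivity)]
    nlinarith
  have h6 : 4 ≤ C * (η ^ 2)⁻¹ := by nlinarith
  have h7 : (m : ℝ) ≤ C * (η ^ 2)⁻¹ * m * Real.log (m / (2 * δ)) := by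
    calc (m : ℝ) ≤ 4 * m * (3 / 5) := by linarith
      _ ≤ _ := by gcongr
  exact_mod_cast h7.trans hN

theorem I₁_nonneg {F δ : ℝ} {N : ℕ} (hδ : 0 < δ) (hδ1 : δ < 1) : 0 ≤ I₁ F N δ := by
  have h := (Real.log_pos one_lt_two).le.trans (log_two_le_log_two_div hδ hδ1)
  rw [I₁_eq]
  positivity

theorem I₂_nonneg {F δ : ℝ} (hδ : 0 < δ) (hδ1 : δ < 1) : 0 ≤ I₂ F δ := by
  have h := (Real.log_pos one_lt_two).le.trans (log_two_le_log_two_div hδ hδ1)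
  unfold I₂
  positivity

theorem I₁_le {F δ : ℝ} {N : ℕ} (hδ : 0 < δ) (hδ1 : δ < 1) :
    I₁ F N δ ≤ 96 * F ^ 2 * Real.log (2 / δ) ^ 2 / N := by
  have h := log_two_le_log_two_div hδ hδ1
  have h2 := Real.log_two_gt_d9
  rw [I₁_eq, show 96 * F ^ 2 * Real.log (2 / δ) ^ 2 / N
    = F ^ 2 / N * (96 * Real.log (2 / δ) ^ 2) by ring]
  gcongr
  nlinarith

theorem I₂_le {F δ : ℝ} (hδ : 0 < δ) (hδ1 : δ < 1) :
    I₂ F δ ≤ 12 * Real.log (2 / δ) * F ^ 2 := by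
  have h := log_two_le_log_two_div hδ hδ1
  have h2 := Real.log_two_gt_d9
  set l := Real.log (2 / δ)
  have h3 : Real.sqrt (2 * l) ≤ 3 * l := by
    rw [Real.sqrt_le_left (by linarith)]
    nlinarith
  rw [I₂, show F ^ 2 + 4 * F ^ 2 * l + Real.sqrt (2 * l) * F ^ 2
    = (1 + 4 * l + Real.sqrt (2 * l)) * F ^ 2 by ring]
  gcongr
  linarith

theorem setIntegral_sq_le_of_cond_le {d : ℕ} {D : Set (EuclideanSpace ℝ (Fin d))}
    (hD : volume D ≠ ⊤) {u : EuclideanSpace ℝ (Fin d) → ℝ} {b : ℝ}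
    (h : volume D ≠ 0 → ∫ x, u x ∂(cond volume D) ≤ b) :
    ∫ x in D, u x ≤ volume.real D * b := by
  by_cases h0 : volume D = 0
  · simp [Measure.restrict_eq_zero.2 h0, measureReal_def, h0]
  · have := h h0
    rw [ProbabilityTheory.cond, integral_smul_measure, ENNReal.toReal_inv, smul_eq_mul, ← measureReal_def] at this
    rwa [inv_mul_le_iff₀ (show 0 < volume.real D from ENNReal.toReal_pos h0 hD)] at this

theorem error_bound {d m : ℕ} {D : Set (EuclideanSpace ℝ (Fin d))}
    {X : Fin m → EuclideanSpace ℝ (Fin d)} (hD : IsCompact D) (hm : 0 < m) (hX : ∀ j, X j ∈ D)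
    {C : ℝ} (hC1 : 1 ≤ C) (hC : ∀ (x : EuclideanSpace ℝ (Fin d)) (r : ℝ), 0 ≤ r →
      volume.real (Metric.closedBall x r) ≤ C * r ^ d)
    {f g p : EuclideanSpace ℝ (Fin d) → ℂ} (hf : ContinuousOn f D) (hg : ContinuousOn g D)
    (hp : ContinuousOn p D) (hpX : ∀ j, p (X j) = f (X j)) {a b η L : ℝ} (ha : 0 ≤ a) (hb : 0 ≤ b)
    (hη : 0 < η) (hη2 : η < 1 / 2) (hL : 0 < L)
    (hint : ∫ x in D, ‖g x - f x‖ ^ 2 ≤ volume.real D * a)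
    (hsum : ∑ j, ‖g (X j) - f (X j)‖ ^ 2 ≤ m * a)
    (hlip : ∀ x₁ ∈ D, ∀ x₂ ∈ D, ‖(g x₁ - p x₁) - (g x₂ - p x₂)‖ ≤ L * ‖x₁ - x₂‖) :
    ∫ x in D, ‖f x - p x‖ ^ 2 ≤ 2 * volume.real D * a
      + 4 * L ^ 2 * fillDistance D X ^ 2 * volume.real D
      + 2 * C * fillDistance D X ^ d * (1 + 2 * η) * (2 * m / (1 - 2 * η) * a + 2 * b) := by
  have h1 := setIntegral_sq_sub_le hD hf hg hp
  have h2 := setIntegral_sq_le_of_lipschitz hD hm hX hC (g := fun x => g x - p x) hlip hL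
  simp only [hpX] at h2
  have h0 : 0 ≤ fillDistance D X ^ d := pow_nonneg fillDistance_nonneg d
  have h3 : 2 * C * fillDistance D X ^ d * ∑ j, ‖g (X j) - f (X j)‖ ^ 2
      ≤ 2 * C * fillDistance D X ^ d * (m * a) := by gcongr
  -- The left side is what the covering argument yields; the right side is larger because `1 - 2η ≤
  -- 1 ≤ 1 + 2η` and `b ≥ 0`.
  have h4 : 2 * (m * a) ≤ (1 + 2 * η) * (2 * m / (1 - 2 * η) * a + 2 * b) := by
    have h5 : 2 * m ≤ 2 * m / (1 - 2 * η) := by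
      rw [le_div_iff₀ (by linarith)]
      nlinarith [(Nat.cast_nonneg m : (0 : ℝ) ≤ m)]
    have h6 : 2 * (m * a) ≤ 2 * m / (1 - 2 * η) * a := by
      rw [← mul_assoc]
      gcongr
    have h7 : 0 ≤ m * a := by positivity
    nlinarith
  have h8 : 2 * C * fillDistance D X ^ d * (2 * (m * a)) ≤ 2 * C * fillDistance D X ^ d *
      ((1 + 2 * η) * (2 * m / (1 - 2 * η) * a + 2 * b)) := by gcongr
  linarith

theorem random_feature_bound {d m N : ℕ} {D : Set (EuclideanSpace ℝ (Fin d))}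
    {X : Fin m → EuclideanSpace ℝ (Fin d)} {C η δ : ℝ} {γ : ℝ≥0}
    {f fhat : EuclideanSpace ℝ (Fin d) → ℂ} [IsProbabilityMeasure (law d γ)]
    (hC1 : 1 ≤ C) (hC : ∀ (x : EuclideanSpace ℝ (Fin d)) (r : ℝ), 0 ≤ r →
      volume.real (Metric.closedBall x r) ≤ C * r ^ d)
    (hD : IsCompact D) (hm : 0 < m) (hX : ∀ j, X j ∈ D) (hinj : Function.Injective X)
    (hγ : 0 < γ) (hf : InSpace γ D f fhat) (hη : 0 < η) (hη2 : η < 1 / 2) (hδ : 0 < δ)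
    (hδ5 : δ < 1 / 5) (hmN : m ≤ N) :
    (Measure.pi fun _ : Fin N => law d γ) {w | ¬ ((∃! c, IsMinNormSolution
          (featureMatrix w X) (fun j => f (X j)) c) ∧
        ∀ c, IsMinNormSolution (featureMatrix w X) (fun j => f (X j)) c →
          IntegrableOn (fun x => ‖f x - model w c x‖ ^ 2) D ∧
          ∀ L : ℝ, 0 < L →
            (∀ x₁ ∈ D, ∀ x₂ ∈ D,
              ‖(bestModel γ fhat w x₁ - model w c x₁)
                - (bestModel γ fhat w x₂ - model w c x₂)‖ ≤ L * ‖x₁ - x₂‖) →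
            ∫ x in D, ‖f x - model w c x‖ ^ 2 ≤
              2 * volume.real D * I₁ (rhoNorm γ fhat) N δ
              + 4 * L ^ 2 * fillDistance D X ^ 2 * volume.real D
              + 2 * C * fillDistance D X ^ d * (1 + 2 * η)
                * (2 * m / (1 - 2 * η) * I₁ (rhoNorm γ fhat) N δ
                  + 2 * I₂ (rhoNorm γ fhat) δ))} ≤ ENNReal.ofReal (5 * δ) := by
  have hN : 0 < N := hm.trans_le hmN
  have : Nonempty (Fin m) := ⟨⟨0, hm⟩⟩
  have hδ1 : δ < 1 := by linarith
  set π := Measure.pi fun _ : Fin N => law d γ with hπ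
  let φ : EuclideanSpace ℝ (Fin d) → ℂ := fun x => ∫ v, amplitude γ fhat v * feature v x ∂(law d γ)
  have hφ : Continuous φ := continuous_integral_amplitude hf.memLp_amplitude
  have hfφ : Set.EqOn f φ D := fun x hx => by
    rw [hf.eq_integral x hx, integral_mul_feature_eq hγ]
  have hfc : ContinuousOn f D := hφ.continuousOn.congr hfφ
  have hfin : volume D ≠ ⊤ := hD.measure_lt_top.ne
  -- The uniform law on `D` is a probability measure only if `D` has positive volume; for null `D`
  -- the integral over `D` is 0 and no event is needed.
  let B₁ := {w : Fin N → EuclideanSpace ℝ (Fin d) | volume D ≠ 0 ∧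
    I₁ (rhoNorm γ fhat) N δ < ∫ x, ‖bestModel γ fhat w x - φ x‖ ^ 2 ∂(cond volume D)}
  let τ := (PMF.uniformOfFintype (Fin m)).toMeasure
  let B₂ := {w : Fin N → EuclideanSpace ℝ (Fin d) |
    I₁ (rhoNorm γ fhat) N δ < ∫ j, ‖bestModel γ fhat w (X j) - φ (X j)‖ ^ 2 ∂τ}
  let B₃ := {w : Fin N → EuclideanSpace ℝ (Fin d) |
    ¬ ((featureMatrix w X).submatrix id (Fin.castLE hmN)).det ≠ 0}
  have hB₁ : π B₁ ≤ ENNReal.ofReal δ := by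
    by_cases h0 : volume D = 0
    · simp [B₁, h0]
    · have := cond_isProbabilityMeasure_of_finite h0 hfin
      refine (measure_mono fun w hw => hw.2).trans
        (measure_I₁_lt_bestModel_le hf.memLp_amplitude hN (cond volume D) measurable_id hδ hδ5)
  have hB₂ : π B₂ ≤ ENNReal.ofReal δ :=
    measure_I₁_lt_bestModel_le hf.memLp_amplitude hN τ (measurable_of_finite X) hδ hδ5
  have hB₃ : π B₃ = 0 :=
    pi_absolutelyContinuous _ _ (withDensity_absolutelyContinuous _ _) N
      (ae_iff.1 (ae_det_feature_ne_zero X hinj hmN))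
  have hunion : π (B₁ ∪ B₂ ∪ B₃) ≤ ENNReal.ofReal (5 * δ) :=
    calc π (B₁ ∪ B₂ ∪ B₃) ≤ π B₁ + π B₂ + π B₃ :=
          (measure_union_le _ _).trans (add_le_add_left (measure_union_le _ _) _)
      _ ≤ ENNReal.ofReal δ + ENNReal.ofReal δ + 0 := by
          gcongr
          exact hB₃.le
      _ = ENNReal.ofReal (δ + δ) := by rw [add_zero, ENNReal.ofReal_add hδ.le hδ.le]
      _ ≤ ENNReal.ofReal (5 * δ) := ENNReal.ofReal_le_ofReal (by linarith)
  refine (measure_mono ?_).trans hunion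
  intro w hw
  by_contra hgood
  refine hw ?_
  simp only [Set.mem_union, not_or] at hgood
  obtain ⟨⟨h₁, h₂⟩, h₃⟩ := hgood
  have h₁' : volume D ≠ 0 →
      ∫ x, ‖bestModel γ fhat w x - φ x‖ ^ 2 ∂(cond volume D) ≤ I₁ (rhoNorm γ fhat) N δ :=
    fun h0 => not_lt.1 fun h => h₁ ⟨h0, h⟩
  have h₂' : ∫ j, ‖bestModel γ fhat w (X j) - φ (X j)‖ ^ 2 ∂τ ≤ I₁ (rhoNorm γ fhat) N δ :=
    not_lt.1 h₂
  have h₃' : ((featureMatrix w X).submatrix id (Fin.castLE hmN)).det ≠ 0 := not_not.1 h₃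
  refine ⟨existsUnique_isMinNormSolution _ _
    (exists_mulVec_eq_of_det_ne_zero _ _ h₃' _), fun c hc => ?_⟩
  have hmc := (continuous_model w c).continuousOn (s := D)
  refine ⟨((hfc.sub hmc).norm.pow 2).integrableOn_compact hD, fun L hL hlip => ?_⟩
  refine error_bound hD hm hX hC1 hC hfc (continuous_bestModel fhat w).continuousOn hmc
    (fun j => ?_) (I₁_nonneg hδ hδ1) (I₂_nonneg hδ hδ1) hη hη2 hL ?_ ?_ hlip
  · rw [← congrFun hc.1 j]
    simp [model, featureMatrix, Matrix.mulVec, dotProduct, mul_comm]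
  · rw [setIntegral_congr_fun hD.measurableSet
      (g := fun x => ‖bestModel γ fhat w x - φ x‖ ^ 2) fun x hx => by simp only [hfφ hx]]
    exact setIntegral_sq_le_of_cond_le hfin h₁'
  · rw [PMF.integral_eq_sum] at h₂'
    simp only [PMF.uniformOfFintype_apply, Fintype.card_fin, ENNReal.toReal_inv,
      ENNReal.toReal_natCast, smul_eq_mul, ← Finset.mul_sum] at h₂'
    rw [inv_mul_le_iff₀ (by exact_mod_cast hm)] at h₂'
    simpa only [hfφ (hX _)] using h₂'

end CauchyRF

theorem theorem3p1 :
    ∃ C : ℝ, 0 < C ∧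
      ∀ (d m N : ℕ) (D : Set (EuclideanSpace ℝ (Fin d))) (X : Fin m → EuclideanSpace ℝ (Fin d))
        (K η δ : ℝ) (γ : ℝ≥0) (f fhat : EuclideanSpace ℝ (Fin d) → ℂ)
        (Ω : Type*) [MeasurableSpace Ω] (P : Measure Ω) [IsProbabilityMeasure P]
        (w : Fin N → Ω → EuclideanSpace ℝ (Fin d)),
        IsCompact D → 0 < m → (∀ j, X j ∈ D) →
        0 < K → (∀ j j', j ≠ j' → K ≤ ‖X j - X j'‖) →
        0 < γ → (∀ k, HasLaw (w k) (CauchyRF.law d γ) P) → iIndepFun w P →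
        CauchyRF.InSpace γ D f fhat →
        0 < η → η < 1 / 2 → 0 < δ → δ < 1 →
        C * (η ^ 2)⁻¹ * m * Real.log (m / (2 * δ)) ≤ N →
        1 / K * Real.log (m / η) ≤ γ →
        (∃ S : Set Ω, MeasurableSet S ∧ 1 - 5 * δ ≤ P.real S ∧ ∀ s ∈ S,
          (∃! c, CauchyRF.IsMinNormSolution
            (CauchyRF.featureMatrix (fun k => w k s) X) (fun j => f (X j)) c) ∧
          ∀ c, CauchyRF.IsMinNormSolution
              (CauchyRF.featureMatrix (fun k => w k s) X) (fun j => f (X j)) c →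
            IntegrableOn (fun x => ‖f x - CauchyRF.model (fun k => w k s) c x‖ ^ 2) D ∧
            ∀ L : ℝ, 0 < L →
              (∀ x₁ ∈ D, ∀ x₂ ∈ D,
                ‖(CauchyRF.bestModel γ fhat (fun k => w k s) x₁
                    - CauchyRF.model (fun k => w k s) c x₁)
                  - (CauchyRF.bestModel γ fhat (fun k => w k s) x₂
                    - CauchyRF.model (fun k => w k s) c x₂)‖ ≤ L * ‖x₁ - x₂‖) →
              ∫ x in D, ‖f x - CauchyRF.model (fun k => w k s) c x‖ ^ 2 ≤
                2 * volume.real D * CauchyRF.I₁ (CauchyRF.rhoNorm γ fhat) N δ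
                + 4 * L ^ 2 * CauchyRF.fillDistance D X ^ 2 * volume.real D
                + 2 * C * CauchyRF.fillDistance D X ^ d * (1 + 2 * η)
                  * (2 * m / (1 - 2 * η) * CauchyRF.I₁ (CauchyRF.rhoNorm γ fhat) N δ
                    + 2 * CauchyRF.I₂ (CauchyRF.rhoNorm γ fhat) δ)) ∧
        CauchyRF.I₁ (CauchyRF.rhoNorm γ fhat) N δ
          ≤ 96 * CauchyRF.rhoNorm γ fhat ^ 2 * Real.log (2 / δ) ^ 2 / N ∧
        CauchyRF.I₂ (CauchyRF.rhoNorm γ fhat) δ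
          ≤ 12 * Real.log (2 / δ) * CauchyRF.rhoNorm γ fhat ^ 2 := by
  obtain ⟨C, hC1, hC⟩ := CauchyRF.exists_volume_closedBall_le
  refine ⟨C, by linarith, ?_⟩
  intro d m N D X K η δ γ f fhat Ω _ P _ w hD hm hX hK hsep hγ hlaw hind hf hη hη2 hδ hδ1 hN _
  refine ⟨?_, CauchyRF.I₁_le hδ hδ1, CauchyRF.I₂_le hδ hδ1⟩
  -- For `δ ≥ 1/5` the required probability `1 - 5δ` is not positive, and the empty event suffices.
  by_cases hδ5 : δ < 1 / 5
  · have hmN := CauchyRF.le_of_sample_bound hC1 hm hη hη2 hδ hδ5 hN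
    -- The total mass 1 is inherited from `P` through the law of one sample, which exists because `0
    -- < m ≤ N`.
    have : IsProbabilityMeasure (CauchyRF.law d γ) :=
      (hlaw ⟨0, hm.trans_le hmN⟩).isProbabilityMeasure_iff.1 inferInstance
    have hinj : Function.Injective X := by
      intro j j' h
      by_contra hne
      have := hsep j j' hne
      rw [h, sub_self, norm_zero] at this
      linarith
    obtain ⟨S, hS, hPS, hgood⟩ := CauchyRF.exists_measurableSet_forall_notMem
      (CauchyRF.hasLaw_pi hlaw hind) (by linarith)
      (CauchyRF.random_feature_bound hC1 (hC d) hD hm hX hinj hγ hf hη hη2 hδ hδ5 hmN)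
    exact ⟨S, hS, hPS, fun s hs => not_not.1 (hgood s hs)⟩
  · refine ⟨∅, MeasurableSet.empty, ?_, fun s hs => hs.elim⟩
    rw [measureReal_empty]
    linarith
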